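/- Let $d\ge 2$ be an integer and let $f(x)=x^d+c$, where $c$ is an indeterminate; write $f^k$ for the $k$-th iterate of $f$ in $x$, with $f^0(x)=x$. For $n\ge 1$ let $$\Phi^*_{f,n}(x)=\prod_{k\mid n}\bigl(f^k(x)-x\bigr)^{\mu(n/k)}\in\mathbb{Z}[c][x]$$ be the dynatomic polynomial, where $\mu$ is the Möbius function. Put $\Phi^*_{f,0,n}=\Phi^*_{f,n}$ and, for $m\ge 1$, $$\Phi^*_{f,m,n}(x)=\frac{\Phi^*_{f,n}(f^m(x))}{\Phi^*_{f,n}(f^{m-1}(x))}\in\mathbb{Z}[c][x].$$ The Misiurewicz polynomial $G_d(m,n)\in\mathbb{Z}[c]$ is $$G_d(m,n)=\begin{cases}\dfrac{\Phi^*_{f,m,n}(0)}{\Phi^*_{f,0,n}(0)^{\,d-1}} & \text{if } m\neq 0 \text{ and } n\mid m-1,\\[2mm] \Phi^*_{f,m,n}(0) & \text{otherwise.}\end{cases}$$ (All these quotients are polynomials.) Corollary 1.1. The polynomial $G_d(m,n)$ is irreducible over $\mathbb{Q}$ in the following two cases: (i) $m\ge 2$, $n=1$ and $d$ is any prime; (ii)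 $m\ge 2$, $n=2$ and $d=2$. (For $m=1$ the polynomials $G_d(1,1)$ and $G_2(1,2)$ are the constant $1$.) -/

import Mathlib

open Polynomial

namespace Misiurewicz

/-- The generic unicritical polynomial `f(x) = x ^ d + c`. The outer variable is `x`, the coefficients
are polynomials over `ℤ` in the parameter `c` (the inner variable). -/
noncomputable def f (d : ℕ) : ℤ[X][X] := X ^ d + C X

/-- The `k`-th iterate `f^k(x)` under composition, with `f^0(x) = x`. -/
noncomputable def iter (d k : ℕ) : ℤ[X][X] := (f d).comp^[k] X

/-- The dynatomic polynomial `Φ*_{f,n}(x) = ∏_{k ∣ n} (f^k(x) - x) ^ μ(n/k)`. The factors of exponent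
`μ(n/k) = 1` form the numerator, those of exponent `-1` the denominator. For `d ≥ 2` the denominator is
monic in `x`, and for `n ≥ 1` the division is exact. -/
noncomputable def dynatomic (d n : ℕ) : ℤ[X][X] :=
  (∏ k ∈ n.divisors with ArithmeticFunction.moebius (n / k) = 1, (iter d k - X)) /ₘ
    (∏ k ∈ n.divisors with ArithmeticFunction.moebius (n / k) = -1, (iter d k - X))

/-- The generalized dynatomic polynomial
`Φ*_{f,m,n}(x) = Φ*_{f,n}(f^m(x)) / Φ*_{f,n}(f^(m-1)(x))` for `m ≥ 1`, and `Φ*_{f,0,n} = Φ*_{f,n}`.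
For `d ≥ 2` the denominator is monic in `x`, and for `n ≥ 1` the division is exact. -/
noncomputable def genDynatomic (d : ℕ) : ℕ → ℕ → ℤ[X][X]
  | 0, n => dynatomic d n
  | m + 1, n => (dynatomic d n).comp (iter d (m + 1)) /ₘ (dynatomic d n).comp (iter d m)

/-- The Misiurewicz polynomial `G_d(m,n)`, a polynomial over `ℤ` in the parameter `c`:
`Φ*_{f,m,n}(0) / Φ*_{f,0,n}(0) ^ (d-1)` if `m ≠ 0` and `n ∣ m - 1`, and `Φ*_{f,m,n}(0)` otherwise.
For `d ≥ 2` and `n ≥ 1` the denominator is monic in `c` and the division is exact. -/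
noncomputable def G (d m n : ℕ) : ℤ[X] :=
  if m ≠ 0 ∧ n ∣ m - 1 then
    (genDynatomic d m n).eval 0 /ₘ ((genDynatomic d 0 n).eval 0) ^ (d - 1)
  else
    (genDynatomic d m n).eval 0

end Misiurewicz

namespace Misiurewicz

/-! Write a_k = f^k(0). Each G is monic, is a power of c - r modulo a prime p, and takes the value p
at c = r, so Eisenstein applies after shifting by r. For n = 1, p = d, r = 0: Frobenius gives
a_{k+1} - a_k ≡ c^(d^k), and G_d(m,1) divides such a difference. With a_k = c b_k and b_k(0) = 1, it
is a sum of d monomials in b_m and b_{m-1}, each equal to 1 at c = 0. For n = d = 2, p = 2, r = -1: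
Φ*_{f,m,2}(0) = a_m - a_{m-1} + 1 ≡ (c + 1)^(2^(m-1)). At c = -1 the orbit alternates 0, -1, so the
value is 2 for m even and 0 for m odd. In the odd case G is the quotient by c + 1, whose value at -1
is the derivative there, again 2. -/

/-- Eisenstein's criterion for `p`, centred at an integer `r`. -/
lemma irreducible_map_of_dvd_X_sub_C_pow {p : ℕ} (hp : p.Prime) {P : ℤ[X]} (hP : P.Monic) (r : ℤ)
    (N : ℕ) (hdvd : P.map (Int.castRingHom (ZMod p)) ∣ (X - C (r : ZMod p)) ^ N)
    (heval : P.eval r = p) : Irreducible (P.map (Int.castRingHom ℚ)) := by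
  have : Fact p.Prime := ⟨hp⟩
  obtain ⟨j, -, hj⟩ := (dvd_prime_pow (prime_X_sub_C (r : ZMod p)) N).1 hdvd
  have hPj : P.map (Int.castRingHom (ZMod p)) = (X - C (r : ZMod p)) ^ j :=
    eq_of_monic_of_associated (hP.map _) ((monic_X_sub_C _).pow j) hj
  have hdeg : P.natDegree = j := by
    rw [← hP.natDegree_map (Int.castRingHom (ZMod p)), hPj,
      (monic_X_sub_C _).natDegree_pow, natDegree_X_sub_C, mul_one]
  have hjpos : 0 < j := by
    rcases Nat.eq_zero_or_pos j with rfl | h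
    · exfalso
      have h1 := eq_one_of_monic_natDegree_zero hP hdeg
      rw [h1, eval_one] at heval
      exact hp.one_lt.ne (by exact_mod_cast heval)
    · exact h
  have key : Irreducible P := by
    have hq : (X - C r : ℤ[X]).map (algebraMap ℤ (ZMod p)) = X - C (r : ZMod p) := by simp
    refine generalizedEisenstein (K := ZMod p) (q := X - C r) (p := j) ?_ (monic_X_sub_C r)
      hP.isPrimitive (hdeg ▸ hjpos) ?_ ?_ ?_
    · rw [hq]
      exact irreducible_X_sub_C _
    · simp [hP.leadingCoeff]
    · rw [hq, hP.leadingCoeff, map_one, C_1, one_mul]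
      exact hPj
    -- The remainder of `P` modulo `X - r` is the constant `p`, which is not in the square of the
    -- ideal `(p)`.
    · have hker : RingHom.ker (algebraMap ℤ (ZMod p)) = Ideal.span {(p : ℤ)} :=
        ZMod.ker_intCastRingHom p
      rw [modByMonic_X_sub_C_eq_C_eval, map_C, heval, Ne, C_eq_zero, Ideal.Quotient.eq_zero_iff_mem,
        hker, Ideal.span_singleton_pow, Ideal.mem_span_singleton]
      intro h
      have h' : p ^ 2 ∣ p ^ 1 := by
        rw [pow_one]
        exact_mod_cast h
      exact absurd (Nat.pow_dvd_pow_iff_le_right hp.one_lt |>.1 h') (by norm_num)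
  exact (hP.irreducible_iff_irreducible_map_fraction_map (K := ℚ)).1 key

/-! ### Iterates and the critical orbit -/

lemma monic_pow_add {R : Type*} [CommRing R] [Nontrivial R] {u w : R[X]} {d : ℕ} (hd : 2 ≤ d)
    (hu : u.Monic) (h1 : 1 ≤ u.natDegree) (hw : w.natDegree ≤ 1) :
    (u ^ d + w).Monic ∧ u.natDegree < (u ^ d + w).natDegree := by
  have hpow : (u ^ d).natDegree = d * u.natDegree := hu.natDegree_pow d
  have hlt : w.natDegree < (u ^ d).natDegree := by rw [hpow]; nlinarith
  refine ⟨(hu.pow d).add_of_left (degree_lt_degree hlt), ?_⟩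
  rw [natDegree_add_eq_left_of_natDegree_lt hlt, hpow]
  nlinarith

lemma monic_of_recurrence {R : Type*} [CommRing R] [Nontrivial R] {u : ℕ → R[X]} {w : R[X]} {d : ℕ}
    (hd : 2 ≤ d) (h0 : (u 0).Monic) (h1 : 1 ≤ (u 0).natDegree) (hw : w.natDegree ≤ 1)
    (hu : ∀ k, u (k + 1) = u k ^ d + w) (k : ℕ) :
    (u k).Monic ∧ 1 ≤ (u k).natDegree ∧ (u k).natDegree < (u (k + 1)).natDegree := by
  induction k with
  | zero =>
    refine ⟨h0, h1, ?_⟩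
    rw [hu]
    exact (monic_pow_add hd h0 h1 hw).2
  | succ k ih =>
    obtain ⟨hm, hpos, hlt⟩ := ih
    have hm' : (u (k + 1)).Monic := by
      rw [hu]
      exact (monic_pow_add hd hm hpos hw).1
    refine ⟨hm', by omega, ?_⟩
    rw [hu (k + 1)]
    exact (monic_pow_add hd hm' (by omega) hw).2

lemma iter_zero (d : ℕ) : iter d 0 = X := rfl

lemma f_comp (d : ℕ) (p : ℤ[X][X]) : (f d).comp p = p ^ d + C X := by
  simp [f]

lemma iter_succ (d k : ℕ) : iter d (k + 1) = iter d k ^ d + C X := by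
  rw [iter, Function.iterate_succ_apply', f_comp, ← iter]

lemma iter_one (d : ℕ) : iter d 1 = X ^ d + C X := by
  rw [iter_succ, iter_zero]

lemma iter_monic {d : ℕ} (hd : 2 ≤ d) (k : ℕ) :
    (iter d k).Monic ∧ 1 ≤ (iter d k).natDegree ∧
      (iter d k).natDegree < (iter d (k + 1)).natDegree :=
  monic_of_recurrence hd (by rw [iter_zero]; exact monic_X) (by rw [iter_zero, natDegree_X])
    (by rw [natDegree_C]; exact Nat.zero_le _) (iter_succ d) k

lemma iter_succ_sub_iter_monic {d : ℕ} (hd : 2 ≤ d) (k : ℕ) :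
    (iter d (k + 1) - iter d k).Monic :=
  (iter_monic hd (k + 1)).1.sub_of_left (degree_lt_degree (iter_monic hd k).2.2)

/-- The critical orbit `f^k(0)`, as polynomials in the parameter. -/
noncomputable def orbit (d k : ℕ) : ℤ[X] := (iter d k).eval 0

lemma orbit_zero (d : ℕ) : orbit d 0 = 0 := by
  rw [orbit, iter_zero, eval_X]

lemma orbit_succ (d k : ℕ) : orbit d (k + 1) = orbit d k ^ d + X := by
  simp [orbit, iter_succ]

lemma orbit_one {d : ℕ} (hd : d ≠ 0) : orbit d 1 = X := by
  rw [orbit_succ, orbit_zero, zero_pow hd, zero_add]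

lemma orbit_succ_monic {d : ℕ} (hd : 2 ≤ d) (k : ℕ) :
    (orbit d (k + 1)).Monic ∧ 1 ≤ (orbit d (k + 1)).natDegree ∧
      (orbit d (k + 1)).natDegree < (orbit d (k + 2)).natDegree :=
  monic_of_recurrence (u := fun k => orbit d (k + 1)) hd
    (by simp only [zero_add]; rw [orbit_one (by omega)]; exact monic_X)
    (by simp only [zero_add]; rw [orbit_one (by omega), natDegree_X]) natDegree_X_le
    (fun k => orbit_succ d (k + 1)) k

lemma orbit_succ_sub_orbit_monic {d : ℕ} (hd : 2 ≤ d) (k : ℕ) :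
    (orbit d (k + 2) - orbit d (k + 1)).Monic :=
  (orbit_succ_monic hd (k + 1)).1.sub_of_left (degree_lt_degree (orbit_succ_monic hd k).2.2)

lemma exists_orbit_eq_X_mul {d : ℕ} (hd : 2 ≤ d) (k : ℕ) :
    ∃ b : ℤ[X], orbit d (k + 1) = X * b ∧ b.eval 0 = 1 := by
  induction k with
  | zero => exact ⟨1, by rw [zero_add, orbit_one (by omega), mul_one], eval_one⟩
  | succ k ih =>
    obtain ⟨b, hb, -⟩ := ih
    obtain ⟨e, rfl⟩ : ∃ e, d = e + 2 := ⟨d - 2, by omega⟩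
    refine ⟨X ^ (e + 1) * b ^ (e + 2) + 1, ?_, by simp⟩
    rw [orbit_succ, hb]
    ring

/-- The parameter cancels in consecutive differences, so by Frobenius each is the `d`-th power of
the one before; the first is `X`. -/
lemma map_orbit_succ_sub_orbit {d : ℕ} [Fact d.Prime] (k : ℕ) :
    (orbit d (k + 1) - orbit d k).map (Int.castRingHom (ZMod d)) = X ^ d ^ k := by
  induction k with
  | zero => simp [orbit_zero, orbit_one (Fact.out : d.Prime).ne_zero]
  | succ k ih =>
    have h : orbit d (k + 2) - orbit d (k + 1) = orbit d (k + 1) ^ d - orbit d k ^ d := by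
      linear_combination orbit_succ d (k + 1) - orbit_succ d k
    rw [h, Polynomial.map_sub, Polynomial.map_pow, Polynomial.map_pow, ← sub_pow_char,
      ← Polynomial.map_sub, ih, ← pow_mul, pow_succ]

/-! ### Period 1, prime degree -/

lemma dynatomic_one (d : ℕ) : dynatomic d 1 = X ^ d + C X - X := by
  simp [dynatomic, Finset.filter_singleton, iter_one]

lemma genDynatomic_succ_one {d : ℕ} (hd : 2 ≤ d) (m : ℕ) :
    genDynatomic d (m + 1) 1 =
      ∑ i ∈ Finset.range d, iter d (m + 1) ^ i * iter d m ^ (d - 1 - i) := by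
  have hcomp : ∀ k, (dynatomic d 1).comp (iter d k) = iter d (k + 1) - iter d k := fun k => by
    simp [dynatomic_one, iter_succ]
  have hsub : iter d (m + 2) - iter d (m + 1) = iter d (m + 1) ^ d - iter d m ^ d := by
    linear_combination iter_succ d (m + 1) - iter_succ d m
  rw [genDynatomic, hcomp, hcomp, hsub, ← (Commute.all _ _).mul_geom_sum₂,
    mul_divByMonic_cancel_left _ (iter_succ_sub_iter_monic hd m)]

lemma G_one_eq {d : ℕ} (hd : 2 ≤ d) (m : ℕ) {b b' : ℤ[X]} (hb : orbit d m = X * b)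
    (hb' : orbit d (m + 1) = X * b') :
    G d (m + 1) 1 = ∑ i ∈ Finset.range d, b' ^ i * b ^ (d - 1 - i) := by
  have h0 : (genDynatomic d 0 1).eval 0 = X := by
    rw [genDynatomic, dynatomic_one]
    simp [show d ≠ 0 by omega]
  have hnum : (genDynatomic d (m + 1) 1).eval 0 =
      X ^ (d - 1) * ∑ i ∈ Finset.range d, b' ^ i * b ^ (d - 1 - i) := by
    rw [genDynatomic_succ_one hd, eval_finsetSum, Finset.mul_sum]
    refine Finset.sum_congr rfl fun i hi => ?_
    rw [Finset.mem_range] at hi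
    rw [eval_mul, eval_pow, eval_pow, ← orbit, ← orbit, hb, hb', mul_pow, mul_pow]
    nth_rw 3 [show d - 1 = i + (d - 1 - i) by omega]
    rw [pow_add]
    ring
  rw [G, if_pos ⟨Nat.succ_ne_zero m, one_dvd _⟩, h0, hnum,
    mul_divByMonic_cancel_left _ (monic_X_pow _)]

theorem irreducible_G_one {d : ℕ} (hd : d.Prime) (m : ℕ) :
    Irreducible ((G d (m + 2) 1).map (Int.castRingHom ℚ)) := by
  have : Fact d.Prime := ⟨hd⟩
  obtain ⟨b, hb, hb0⟩ := exists_orbit_eq_X_mul hd.two_le m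
  obtain ⟨b', hb', hb0'⟩ := exists_orbit_eq_X_mul hd.two_le (m + 1)
  rw [G_one_eq hd.two_le (m + 1) hb hb']
  set S := ∑ i ∈ Finset.range d, b' ^ i * b ^ (d - 1 - i) with hS
  -- As a factor of an orbit difference, `S` inherits both monicity and the reduction modulo `d`.
  have hmul : (X ^ (d - 1) * (orbit d (m + 2) - orbit d (m + 1))) * S =
      orbit d (m + 3) - orbit d (m + 2) := by
    have hgeom : (b' - b) * S = b' ^ d - b ^ d := (Commute.all _ _).mul_geom_sum₂ d
    have hX : (X : ℤ[X]) ^ d = X ^ (d - 1) * X := by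
      rw [← pow_succ, Nat.sub_add_cancel hd.one_lt.le]
    have h2 := orbit_succ d (m + 1)
    have h3 := orbit_succ d (m + 2)
    rw [hb, mul_pow, hX] at h2
    rw [hb', mul_pow, hX] at h3
    rw [h3, hb, hb']
    linear_combination X ^ (d - 1) * X * hgeom - hb' + h2
  refine irreducible_map_of_dvd_X_sub_C_pow hd ?_ 0 (d ^ (m + 2)) ?_ ?_
  · refine Monic.of_mul_monic_left
      ((monic_X_pow (d - 1)).mul (orbit_succ_sub_orbit_monic hd.two_le m)) ?_
    rw [hmul]
    exact orbit_succ_sub_orbit_monic hd.two_le (m + 1)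
  · rw [Int.cast_zero, C_0, sub_zero, ← map_orbit_succ_sub_orbit (m + 2), ← hmul,
      Polynomial.map_mul]
    exact dvd_mul_left _ _
  · simp [hS, eval_finsetSum, hb0, hb0']

/-! ### Period 2, degree 2 -/

lemma dynatomic_two_two : dynatomic 2 2 = X ^ 2 + X + C X + 1 := by
  have hdiv : Nat.divisors 2 = {1, 2} := by decide
  have hμ : ArithmeticFunction.moebius 2 = -1 :=
    ArithmeticFunction.moebius_apply_prime Nat.prime_two
  have h1 : (iter 2 2 - X) = (iter 2 1 - X) * (X ^ 2 + X + C X + 1) := by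
    rw [iter_succ, iter_one]
    ring
  have hmonic : (iter 2 1 - X).Monic := iter_succ_sub_iter_monic le_rfl 0
  simpa [dynatomic, hdiv, Finset.filter_insert, Finset.filter_singleton, hμ, h1]
    using mul_divByMonic_cancel_left _ hmonic

lemma dynatomic_two_two_comp_iter (k : ℕ) :
    (dynatomic 2 2).comp (iter 2 k) = iter 2 (k + 1) + (iter 2 k + 1) := by
  rw [dynatomic_two_two, iter_succ]
  simp only [add_comp, pow_comp, X_comp, C_comp, one_comp]
  ring

lemma dynatomic_two_two_comp_iter_monic (k : ℕ) : ((dynatomic 2 2).comp (iter 2 k)).Monic := by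
  rw [dynatomic_two_two_comp_iter]
  refine (iter_monic le_rfl (k + 1)).1.add_of_left (degree_lt_degree ?_)
  rw [← C_1, natDegree_add_C]
  exact (iter_monic le_rfl k).2.2

lemma eval_genDynatomic_succ_two (m : ℕ) :
    (genDynatomic 2 (m + 1) 2).eval 0 = orbit 2 (m + 1) - orbit 2 m + 1 := by
  -- With x, y the iterates of order m, m + 1, so c = y - x^2, the left side is (y + 1)^2 - x^2.
  have h : (dynatomic 2 2).comp (iter 2 (m + 1)) =
      (dynatomic 2 2).comp (iter 2 m) * (iter 2 (m + 1) - iter 2 m + 1) := by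
    rw [dynatomic_two_two_comp_iter, dynatomic_two_two_comp_iter, iter_succ 2 (m + 1),
      iter_succ 2 m]
    ring
  rw [genDynatomic, h, mul_divByMonic_cancel_left _ (dynatomic_two_two_comp_iter_monic m)]
  simp [orbit]

lemma orbit_two_sub_add_one_monic (k : ℕ) : (orbit 2 (k + 2) - orbit 2 (k + 1) + 1).Monic := by
  rw [sub_add]
  refine (orbit_succ_monic le_rfl (k + 1)).1.sub_of_left (degree_lt_degree ?_)
  rw [← C_1, natDegree_sub_C]
  exact (orbit_succ_monic le_rfl k).2.2

/-- In characteristic 2, squaring `u - v + 1` gives `(u ^ 2 + X) - (v ^ 2 + X) + 1`, the next term.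
-/
lemma map_orbit_two_sub_add_one (k : ℕ) :
    (orbit 2 (k + 1) - orbit 2 k + 1).map (Int.castRingHom (ZMod 2)) =
      (X - C ((-1 : ℤ) : ZMod 2)) ^ 2 ^ k := by
  have h2 : (2 : (ZMod 2)[X]) = 0 := CharTwo.two_eq_zero
  induction k with
  | zero =>
    simp only [zero_add, orbit_zero, orbit_one two_ne_zero, Polynomial.map_add,
      Polynomial.map_sub, Polynomial.map_zero, Polynomial.map_one, map_X, pow_zero, pow_one,
      Int.cast_neg, Int.cast_one, C_neg, C_1]
    ring
  | succ k ih =>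
    rw [pow_succ, pow_mul, ← ih, orbit_succ 2 (k + 1)]
    have hk := congrArg (Polynomial.map (Int.castRingHom (ZMod 2))) (orbit_succ 2 k)
    simp only [Polynomial.map_sub, Polynomial.map_add, Polynomial.map_pow, Polynomial.map_one,
      map_X] at hk ⊢
    generalize (orbit 2 (k + 1)).map (Int.castRingHom (ZMod 2)) = u at *
    generalize (orbit 2 k).map (Int.castRingHom (ZMod 2)) = v at *
    subst hk
    linear_combination (v * (v ^ 2 + X) - v ^ 2 + v - v ^ 2 - X) * h2

lemma eval_orbit_two (k : ℕ) :
    (orbit 2 (2 * k)).eval (-1) = 0 ∧ (orbit 2 (2 * k + 1)).eval (-1) = -1 := by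
  induction k with
  | zero => simp [orbit_zero, orbit_one]
  | succ k ih =>
    have h : (orbit 2 (2 * k + 2)).eval (-1) = 0 := by
      rw [orbit_succ]
      simp [ih.2]
    refine ⟨h, ?_⟩
    rw [mul_add, mul_one, orbit_succ]
    simp [h]

lemma eval_derivative_orbit_two (k : ℕ) :
    (derivative (orbit 2 (2 * k + 1))).eval (-1) = 1 ∧
      (derivative (orbit 2 (2 * k + 2))).eval (-1) = -1 := by
  have hodd : (derivative (orbit 2 (2 * k + 1))).eval (-1) = 1 := by
    rw [orbit_succ]
    simp [derivative_pow, (eval_orbit_two k).1]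
  refine ⟨hodd, ?_⟩
  rw [orbit_succ]
  simp [derivative_pow, (eval_orbit_two k).2, hodd]

theorem irreducible_G_two_two (m : ℕ) :
    Irreducible ((G 2 (m + 2) 2).map (Int.castRingHom ℚ)) := by
  have h0 : (genDynatomic 2 0 2).eval 0 = X - C (-1) := by
    rw [genDynatomic, dynatomic_two_two]
    simp
  have hmod := map_orbit_two_sub_add_one (m + 1)
  have hmonic := orbit_two_sub_add_one_monic m
  rw [G, h0, eval_genDynatomic_succ_two]
  rcases Nat.even_or_odd' m with ⟨k, rfl | rfl⟩
  · rw [if_neg (by omega)]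
    refine irreducible_map_of_dvd_X_sub_C_pow Nat.prime_two hmonic (-1) _ hmod.dvd ?_
    have h2 := (eval_orbit_two (k + 1)).1
    rw [mul_add, mul_one] at h2
    simp [h2, (eval_orbit_two k).2]
  · rw [if_pos (by omega)]
    set e := orbit 2 (2 * k + 1 + 2) - orbit 2 (2 * k + 1 + 1) + 1 with he
    have h2 := eval_orbit_two (k + 1)
    rw [mul_add, mul_one] at h2
    have hroot : e.IsRoot (-1) := by
      simp [he, IsRoot, show 2 * k + 1 + 2 = 2 * k + 2 + 1 by ring, h2.1, h2.2]
    obtain ⟨q, hq⟩ := dvd_iff_isRoot.2 hroot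
    -- Since `e = (X + 1) * q`, this derivative is `q(-1)`, the value Eisenstein needs.
    have hd : (derivative e).eval (-1) = 2 := by
      have h3 := (eval_derivative_orbit_two (k + 1)).1
      rw [mul_add, mul_one] at h3
      simp [he, show 2 * k + 1 + 2 = 2 * k + 2 + 1 by ring, h3, (eval_derivative_orbit_two k).2]
    rw [hq, show 2 - 1 = 1 from rfl, pow_one, mul_divByMonic_cancel_left _ (monic_X_sub_C _)]
    refine irreducible_map_of_dvd_X_sub_C_pow Nat.prime_two
      ((monic_X_sub_C (-1)).of_mul_monic_left (hq ▸ hmonic)) (-1) (2 ^ (2 * k + 1 + 1)) ?_ ?_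
    · rw [← hmod, hq, Polynomial.map_mul]
      exact dvd_mul_left _ _
    · rw [hq] at hd
      simpa using hd

end Misiurewicz

theorem corollary1p1 :
    (∀ d m : ℕ, d.Prime → 2 ≤ m →
      Irreducible ((Misiurewicz.G d m 1).map (Int.castRingHom ℚ))) ∧
    (∀ m : ℕ, 2 ≤ m →
      Irreducible ((Misiurewicz.G 2 m 2).map (Int.castRingHom ℚ))) := by
  refine ⟨fun d m hd hm => ?_, fun m hm => ?_⟩
  · obtain ⟨k, rfl⟩ := Nat.exists_eq_add_of_le' hm
    exact Misiurewicz.irreducible_G_one hd k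
  · obtain ⟨k, rfl⟩ := Nat.exists_eq_add_of_le' hm
    exact Misiurewicz.irreducible_G_two_two k
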